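/- A server holds $N$ files $W^1,\dots,W^N$, independent and uniformly distributed on $\{0,1\}^B$. It serves $K\le N$ users over a shared error-free broadcast link, with the help of $\Lambda$ helper caches, $1\le\Lambda\le K$, each of capacity $MB$ bits, and of $K$ dedicated user caches, each of capacity $B$ bits (normalized sizes $M$ and $1$). The system operates as follows. First, the helper caches are filled with functions of the files and of random bits, without knowledge of which user will access which cache. Then every user is assigned to one helper cache; $\mathcal L=(\mathcal L_1\ge\dots\ge\mathcal L_\Lambda)$ denotes the profile of this association, $\mathcal L_r$ being the number of users of the $r$-th most populated helper cache. Then keys, made from fresh random bits that are independent of the files and of the helper caches, are placed privately in the user caches. Finally the demand vector $d\in[N]^K$ is revealed and the server broadcasts a message $X_d(\mathcal L)$. Let $Z_k$ be the content of the helper cache and of the user cache accessed by user $k$. For every association, every $d\in[N]^K$ and every user $k$ it is required that $W^{d_k}$ is determined by $(Z_k,X_d(\mathcal L))$ and that perfect secrecy holds: $$I\big(W^{[N]\setminus d_k};\,Z_k,X_d(\mathcal L)\big)=0 .$$ The rate for $\mathcal L$ is the number of bits of $X_d(\mathcal L)$ divided by $B$. **(a)** Let $M\ge 0$ be such that $t=\frac{\Lambda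 M}{M+N}\in\{0,1,\dots,\Lambda-1\}$. Then there is a $B_1\ge 1$ such that for every positive multiple $B$ of $B_1$ there is a scheme as above whose rate is, for every profile $\mathcal L$, $$R^s(\mathcal L)=\frac{\sum_{r=1}^{\Lambda-t}\mathcal L_r\binom{\Lambda-r}{t}}{\binom{\Lambda-1}{t}} .$$ **(b)** For every real $M\in[0,N(\Lambda-1)]$ the lower convex envelope of the points $(M,R^s(\mathcal L))$ of part (a) is achievable: for every $\varepsilon>0$ there is a $B_1\ge1$ such that for every positive multiple $B$ of $B_1$ there is a scheme as above with helper caches of normalized size at most $M$ and user caches of normalized size at most $1$ whose rate is, for every profile $\mathcal L$, at most the value at $M$ of the lower convex envelope for $\mathcal L$, plus $\varepsilon$. -/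

import Mathlib

open MeasureTheory ProbabilityTheory

/-- Strings of `n` bits. -/
abbrev Bits (n : ℕ) : Type := Fin n → Bool

/-- The mutual information `I(X; Y)` (in nats): the Kullback-Leibler divergence of the joint law of
`X` and `Y` from the product of their laws. -/
noncomputable def mutualInfo {Ω α β : Type*} [MeasurableSpace Ω] [MeasurableSpace α]
    [MeasurableSpace β] (μ : Measure Ω) (X : Ω → α) (Y : Ω → β) : ENNReal :=
  InformationTheory.klDiv (μ.map (fun ω => (X ω, Y ω))) ((μ.map X).prod (μ.map Y))

/-- A user-to-cache association: user `k` accesses the helper cache `U k`. -/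
abbrev Association (K Λ : ℕ) : Type := Fin K → Fin Λ

/-- A demand vector: user `k` requests the file `d k`. -/
abbrev Demand (K N : ℕ) : Type := Fin K → Fin N

/-- `L` is the profile of the association `U`: it is non-increasing, and `L r` is the number of
users of the `r`-th most populated helper cache (counting from `r = 0`), where `σ` lists the caches
by decreasing number of users. -/
def HasProfile {K Λ : ℕ} (U : Association K Λ) (L : Fin Λ → ℕ) : Prop :=
  Antitone L ∧ ∃ σ : Equiv.Perm (Fin Λ), ∀ r : Fin Λ,
    (Finset.univ.filter (fun k : Fin K => U k = σ r)).card = L r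

/-- The data of a caching scheme with shared helper caches and dedicated user caches, for a library
of `N` files of `B` bits, `K` users and `Λ` helper caches. The fields follow the phases of the
system. The helper caches are filled from the files and from random bits, before the association is
known. The user caches are filled with keys, which are made from fresh random bits once the
association, but not the demand, is known. The delivery phase broadcasts a bit string that may
depend on all of this and on the demand. -/
structure CachingScheme (N K Λ B : ℕ) where
  /-- number of random bits used in the helper cache placement phase -/
  helperRandLen : ℕ
  /-- number of bits stored in each helper cache -/
  helperLen : ℕ
  /-- content of the helper cache `l` -/
  helperCache : (l : Fin Λ) → (Fin N → Bits B) → Bits helperRandLen → Bits helperLen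
  /-- number of random bits used in the user cache placement phase -/
  keyRandLen : Association K Λ → ℕ
  /-- number of bits stored in each user cache -/
  userLen : ℕ
  /-- content of the user cache of user `k` -/
  userCache : (U : Association K Λ) → (k : Fin K) → Bits (keyRandLen U) → Bits userLen
  /-- number of bits broadcast in the delivery phase -/
  txLen : Association K Λ → ℕ
  /-- the broadcast message -/
  transmit : (U : Association K Λ) → Demand K N → (Fin N → Bits B) → Bits helperRandLen →
    Bits (keyRandLen U) → Bits (txLen U)

namespace CachingScheme

variable {N K Λ B : ℕ} (S : CachingScheme N K Λ B)

/-- The sample space for the association `U`: the files, the random bits of the helper cache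
placement and the random bits of the user cache placement. -/
abbrev Sample (U : Association K Λ) : Type :=
  (Fin N → Bits B) × Bits S.helperRandLen × Bits (S.keyRandLen U)

/-- The files and all the random bits are independent and uniformly distributed. -/
noncomputable def law (U : Association K Λ) : Measure (S.Sample U) :=
  uniformOn Set.univ

/-- The cache contents that user `k` has access to: its helper cache and its user cache. -/
def cached (U : Association K Λ) (k : Fin K) (ω : S.Sample U) :
    Bits S.helperLen × Bits S.userLen :=
  (S.helperCache (U k) ω.1 ω.2.1, S.userCache U k ω.2.2)

/-- The message broadcast for the demand `d`. -/
def message (U : Association K Λ) (d : Demand K N) (ω : S.Sample U) : Bits (S.txLen U) :=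
  S.transmit U d ω.1 ω.2.1 ω.2.2

/-- Every user recovers, without error, the file it requested from its caches and the broadcast
message; the association and the demand vector are public. -/
def Correct : Prop :=
  ∀ (U : Association K Λ) (d : Demand K N) (k : Fin K),
    ∃ decode : (Bits S.helperLen × Bits S.userLen) × Bits (S.txLen U) → Bits B,
      ∀ ω : S.Sample U, decode (S.cached U k ω, S.message U d ω) = ω.1 (d k)

/-- Perfect secrecy: the caches of user `k` and the broadcast message carry no information about
the collection of all files other than the one requested by user `k`. -/
def PerfectlySecret : Prop :=
  ∀ (U : Association K Λ) (d : Demand K N) (k : Fin K),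
    mutualInfo (S.law U) (fun ω => fun n : {n : Fin N // n ≠ d k} => ω.1 n)
      (fun ω => (S.cached U k ω, S.message U d ω)) = 0

end CachingScheme

/-- The rate `(∑_{r = 1}^{Λ - t} L_r * C(Λ - r, t)) / C(Λ - 1, t)`; as `L` is indexed from `0`,
its entry `L r` is `L_{r + 1}`. -/
noncomputable def secretiveRate (Λ t : ℕ) (L : Fin Λ → ℕ) : ℝ :=
  (∑ r ∈ Finset.univ.filter (fun r : Fin Λ => (r : ℕ) + 1 ≤ Λ - t),
    (L r : ℝ) * ((Λ - ((r : ℕ) + 1)).choose t : ℝ)) / ((Λ - 1).choose t : ℝ)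

/-- The memory-rate points `(M, R)` with `t = Λ M / (M + N)` in `{0, …, Λ - 1}`, for profile `L`. -/
def cornerPoints (N Λ : ℕ) (L : Fin Λ → ℕ) : Set (ℝ × ℝ) :=
  {p | 0 ≤ p.1 ∧ ∃ t : ℕ, t < Λ ∧ (t : ℝ) = (Λ : ℝ) * p.1 / (p.1 + (N : ℝ)) ∧
    p.2 = secretiveRate Λ t L}

/-- The lower convex envelope of a set of points of the plane, as a function of the abscissa. -/
noncomputable def lowerConvexEnvelope (P : Set (ℝ × ℝ)) (x : ℝ) : ℝ :=
  sInf {y : ℝ | (x, y) ∈ convexHull ℝ P}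

/-!
The scheme is linear over `𝔽₂`: `Bool` is a Boolean ring whose addition is `xor`, so the sample
space is a finite group, and everything a user observes is an additive function on it. Decodability
and perfect secrecy then become statements about the kernel of the observation of user `k`
(`exists_factor_of_ker_le`, `mutualInfo_uniformOn_eq_zero`): on that kernel the requested file must
vanish, while the other files must still be arbitrary.

Files are secret-shared by cochains of the simplex on the helper caches. A file is split into bits
`w T`, where `T` runs over the `t`-sets of caches avoiding a fixed cache `o`, and its shares `s T`,
for all `t`-sets `T`, form a random `(t - 1)`-cochain with coboundary `w (S.erase o)` at each set
`S` containing `o`. Helper cache `l` stores the shares at the sets containing `l`. Because cocycles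
of the simplex are coboundaries, a cocycle can be prescribed arbitrarily at the sets containing `l`,
and is then unique, for every `l`; hence the shares in one cache are independent of the file
(`share_eq_zero_of_mem`). This replaces the usual sharing by Cauchy matrices over a large field and
makes the scheme work for all file sizes divisible by `C(Λ - 1, t)`.

In the delivery phase, users of the same rank within their caches are served together: for each
rank and each set `S` of `t + 1` caches, the sum of the shares at `S.erase l` requested at the
caches `l` in `S` is sent, encrypted by a fresh key bit that exactly these users hold. Counting the
sets `S` by their most populated cache gives the rate (`sum_powersetCard_sup_load`).

The scheme is built from layers, each with its own `t`, so that memory sharing is the case of two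
kinds of layers. In the variable `1 / (Λ - t)`, of which the memory is an affine function, the rate
is a nonnegative combination of binomial coefficients `C(Λ - 1 - t, r)` whose secant slopes are
monotone in `t` (`exists_line_le_secretiveRate`). So, for all profiles at once, the lower convex
envelope at `M` interpolates linearly between the two neighbouring integral values of `t`, and
a single scheme mixing these two comes within `ε` of it (`exists_envelopeScheme`).
-/

/-! ### Additive random variables on a uniform finite group -/

/-- An observable `Y` on a uniformly distributed finite group carries no information about an
observable `X` as soon as both are additive and `X` restricted to the kernel of `Y` is onto:
translating by a kernel element changes the value of `X` at will and preserves `Y` and the law. -/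
theorem mutualInfo_uniformOn_eq_zero {Ω α β : Type*} [AddCommGroup Ω] [AddCommGroup α]
    [AddCommGroup β] [Finite Ω] [Finite α] [Finite β]
    [MeasurableSpace Ω] [MeasurableSingletonClass Ω]
    [MeasurableSpace α] [MeasurableSingletonClass α]
    [MeasurableSpace β] [MeasurableSingletonClass β]
    {X : Ω → α} {Y : Ω → β} (hX : ∀ ω v, X (ω + v) = X ω + X v)
    (hY : ∀ ω v, Y (ω + v) = Y ω + Y v) (h : ∀ a, ∃ v, X v = a ∧ Y v = 0) :
    mutualInfo (uniformOn (Set.univ : Set Ω)) X Y = 0 := by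
  have : Fintype Ω := Fintype.ofFinite Ω
  have : Fintype α := Fintype.ofFinite α
  have : Fintype β := Fintype.ofFinite β
  have : IsProbabilityMeasure (uniformOn (Set.univ : Set Ω)) :=
    isProbabilityMeasure_uniformOn Set.finite_univ Set.univ_nonempty
  have hXm : Measurable X := .of_discrete
  have hYm : Measurable Y := .of_discrete
  have hinv : ∀ (v : Ω) (s : Set Ω),
      uniformOn Set.univ ((· + v) ⁻¹' s) = uniformOn (Set.univ : Set Ω) s := by
    intro v s
    rw [uniformOn_univ, uniformOn_univ, Measure.count_apply (Set.toFinite _).measurableSet,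
      Measure.count_apply (Set.toFinite _).measurableSet]
    congr 2
    exact Set.encard_preimage_of_bijective (Equiv.addRight v).bijective s
  set μ : Measure Ω := uniformOn Set.univ with hμ
  have hjoint : ∀ a y, μ (X ⁻¹' {a} ∩ Y ⁻¹' {y}) = μ (X ⁻¹' {0} ∩ Y ⁻¹' {y}) := by
    intro a y
    obtain ⟨v, hv, hv'⟩ := h a
    rw [← hinv v (X ⁻¹' {a} ∩ Y ⁻¹' {y})]
    congr 1
    ext ω
    simp [hX, hY, hv, hv']
  have hYlaw : ∀ y, μ (Y ⁻¹' {y}) = Fintype.card α * μ (X ⁻¹' {0} ∩ Y ⁻¹' {y}) := by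
    intro y
    have := sum_measure_preimage_singleton (μ := μ.restrict (Y ⁻¹' {y})) (f := X)
      Finset.univ (fun a _ => (Set.toFinite _).measurableSet)
    simp only [Measure.restrict_apply (Set.toFinite _).measurableSet, hjoint] at this
    simpa using this.symm
  have hXlaw : ∀ a, μ (X ⁻¹' {a}) = μ (X ⁻¹' {0}) := by
    intro a
    obtain ⟨v, hv, -⟩ := h a
    rw [← hinv v (X ⁻¹' {a})]
    congr 1
    ext ω
    simp [hX, hv]
  have hone : Fintype.card α * μ (X ⁻¹' {0}) = 1 := by
    have := sum_measure_preimage_singleton (μ := μ) (f := X)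
      Finset.univ (fun a _ => (Set.toFinite _).measurableSet)
    simpa [hXlaw] using this
  have hprod : μ.map (fun ω => (X ω, Y ω)) = (μ.map X).prod (μ.map Y) := by
    refine Measure.ext_of_singleton fun ⟨a, y⟩ => ?_
    rw [← Set.singleton_prod_singleton, Measure.prod_prod,
      Measure.map_apply (hXm.prodMk hYm) ((Set.toFinite _).measurableSet),
      Measure.map_apply hXm (measurableSet_singleton a),
      Measure.map_apply hYm (measurableSet_singleton y), hYlaw, hXlaw a, ← mul_assoc,
      mul_comm (μ _), hone, one_mul, ← hjoint a]
    rfl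
  have : IsProbabilityMeasure (μ.map X) := Measure.isProbabilityMeasure_map hXm.aemeasurable
  have : IsProbabilityMeasure (μ.map Y) := Measure.isProbabilityMeasure_map hYm.aemeasurable
  rw [mutualInfo, hprod]
  exact InformationTheory.klDiv_self _

/-- A value of an additive observable `X` can be read off an additive observable `Y` if `X` vanishes
on the kernel of `Y`. -/
theorem exists_factor_of_ker_le {Ω α β : Type*} [AddCommGroup Ω] [AddCommGroup α]
    [AddCommGroup β] {X : Ω → α} {Y : Ω → β} (hX : ∀ ω v, X (ω + v) = X ω + X v)
    (hY : ∀ ω v, Y (ω + v) = Y ω + Y v) (h : ∀ v, Y v = 0 → X v = 0) :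
    ∃ f : β → α, ∀ ω, f (Y ω) = X ω := by
  refine ⟨Function.extend Y X 0, fun ω => Function.FactorsThrough.extend_apply ?_ _ ω⟩
  intro a b hab
  have hYs := hY (a - b) b
  have hXs := hX (a - b) b
  rw [sub_add_cancel] at hYs hXs
  rw [hXs, h (a - b) (by simpa [hab] using hYs), zero_add]

/-! ### Secret sharing by cochains of the simplex -/

section Shares

variable {V : Type*} [DecidableEq V]

/-- The shares `s T` of a file, one for each set `T` of helper caches of a given size. The file is
given by bits `w T` for the sets `T` avoiding the vertex `o`, and the random bits `r T` are the
shares at the sets `T` containing `o`. The remaining shares are chosen such that the coboundary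
`∑ x ∈ S, s (S.erase x)` at every set `S` containing `o` is the file bit `w (S.erase o)`. -/
def share (o : V) (w r : Finset V → Bool) (T : Finset V) : Bool :=
  if o ∈ T then r T else w T + ∑ x ∈ T, r (insert o (T.erase x))

theorem share_add (o : V) (w w' r r' : Finset V → Bool) (T : Finset V) :
    share o (w + w') (r + r') T = share o w r T + share o w' r' T := by
  unfold share
  split_ifs
  · rfl
  · simp only [Pi.add_apply, Finset.sum_add_distrib]
    abel

/-- All the shares together determine the file. -/
theorem eq_zero_of_share_eq_zero {o : V} {w r : Finset V → Bool} {t : ℕ}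
    (h : ∀ T : Finset V, T.card = t → share o w r T = 0) {T : Finset V} (hT : T.card = t)
    (ho : o ∉ T) : w T = 0 := by
  have hsum : ∑ x ∈ T, r (insert o (T.erase x)) = 0 := by
    refine Finset.sum_eq_zero fun x hx => ?_
    have hcard : (insert o (T.erase x)).card = t := by
      rw [Finset.card_insert_of_notMem (fun hm => ho (Finset.mem_of_mem_erase hm)),
        Finset.card_erase_add_one hx, hT]
    have := h _ hcard
    rwa [share, if_pos (Finset.mem_insert_self _ _)] at this
  have := h T hT
  rwa [share, if_neg ho, hsum, add_zero] at this

/-- The shares at the sets containing a fixed vertex `l` say nothing about the file: for every file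
there are random bits for which all these shares vanish. At a set `T` containing `o` but not `l`,
the coboundary equation at `insert l T` forces the choice of `r T`. -/
theorem share_eq_zero_of_mem {o l : V} {w r : Finset V → Bool} {t : ℕ}
    (hr : ∀ T : Finset V, T.card = t → o ∈ T →
      r T = if l ∈ T then 0 else w (insert l (T.erase o)))
    {T : Finset V} (hT : T.card = t) (hl : l ∈ T) : share o w r T = 0 := by
  unfold share
  split_ifs with ho
  · rw [hr T hT ho, if_pos hl]
  · have hlo : l ≠ o := fun e => ho (e ▸ hl)
    have hcard : ∀ x ∈ T, (insert o (T.erase x)).card = t := by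
      intro x hx
      rw [Finset.card_insert_of_notMem (fun hm => ho (Finset.mem_of_mem_erase hm)),
        Finset.card_erase_add_one hx, hT]
    have hsum : ∑ x ∈ T, r (insert o (T.erase x)) = r (insert o (T.erase l)) := by
      refine Finset.sum_eq_single_of_mem l hl fun x hx hxl => ?_
      rw [hr _ (hcard x hx) (Finset.mem_insert_self _ _), if_pos]
      exact Finset.mem_insert_of_mem (Finset.mem_erase.2 ⟨hxl.symm, hl⟩)
    rw [hsum, hr _ (hcard l hl) (Finset.mem_insert_self _ _), if_neg (by simp [hlo]),
      Finset.erase_insert (fun hm => ho (Finset.mem_of_mem_erase hm)), Finset.insert_erase hl]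
    cases w T <;> rfl

end Shares

/-! ### The layered scheme -/

/-- The function on finite sets that agrees with `f` on the sets satisfying `p`, and is zero on the
others. -/
def extendZero {V : Type*} {p : Finset V → Prop} [DecidablePred p] (f : {T // p T} → Bool)
    (T : Finset V) : Bool :=
  if h : p T then f ⟨T, h⟩ else 0

theorem extendZero_of_pos {V : Type*} {p : Finset V → Prop} [DecidablePred p]
    (f : {T // p T} → Bool) {T : Finset V} (h : p T) : extendZero f T = f ⟨T, h⟩ :=
  dif_pos h

theorem extendZero_add {V : Type*} {p : Finset V → Prop} [DecidablePred p]
    (f g : {T // p T} → Bool) : extendZero (f + g) = extendZero f + extendZero g := by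
  funext T
  by_cases h : p T
  · simp [extendZero, h]
  · simp [extendZero, h]

section Association

variable {K Λ : ℕ}

/-- The number of users of the helper cache `l`. -/
def load (U : Association K Λ) (l : Fin Λ) : ℕ := (Finset.univ.filter fun k => U k = l).card

/-- The rank of the user `k` among the users of its helper cache, counted from `0`. -/
def rank (U : Association K Λ) (k : Fin K) : ℕ :=
  (Finset.univ.filter fun k' => k' < k ∧ U k' = U k).card

theorem rank_lt_load (U : Association K Λ) (k : Fin K) : rank U k < load U (U k) := by
  refine Finset.card_lt_card ⟨fun k' hk' => ?_, fun hsub => ?_⟩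
  · simp only [Finset.mem_filter, Finset.mem_univ, true_and] at hk' ⊢
    exact hk'.2
  · simpa using hsub (show k ∈ _ by simp)

theorem rank_lt_rank (U : Association K Λ) {k k' : Fin K} (hU : U k = U k') (hlt : k < k') :
    rank U k < rank U k' := by
  refine Finset.card_lt_card ⟨fun j hj => ?_, fun hsub => ?_⟩
  · simp only [Finset.mem_filter, Finset.mem_univ, true_and] at hj ⊢
    exact ⟨hj.1.trans hlt, hj.2.trans hU⟩
  · simpa using hsub (show k ∈ _ by simp [hlt, hU])

/-- Different users of the same rank access different helper caches. -/
theorem eq_of_rank_eq (U : Association K Λ) {k k' : Fin K} (hU : U k = U k')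
    (hr : rank U k = rank U k') : k = k' := by
  rcases lt_trichotomy k k' with h | h | h
  · exact absurd hr (rank_lt_rank U hU h).ne
  · exact h
  · exact absurd hr (rank_lt_rank U hU.symm h).ne'

end Association

section Positions

variable {K Λ : ℕ} {ι : Type*}

/-- The bits of a file: in each layer `i`, one bit for each set of `τ i` helper caches that does not
contain the cache `o`. -/
abbrev FilePos (τ : ι → ℕ) (o : Fin Λ) : Type _ :=
  Σ i, {T : Finset (Fin Λ) // T.card = τ i ∧ o ∉ T}

/-- The shares of a file stored in the helper cache `l`: in each layer `i`, one bit for each set of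
`τ i` helper caches containing `l`. -/
abbrev SharePos (τ : ι → ℕ) (l : Fin Λ) : Type _ :=
  Σ i, {T : Finset (Fin Λ) // T.card = τ i ∧ l ∈ T}

/-- The broadcast bits: in each layer `i`, for each set `S` of `τ i + 1` helper caches, one bit for
each rank occurring among the users of the caches in `S`. -/
abbrev TxPos (τ : ι → ℕ) (U : Association K Λ) : Type _ :=
  Σ i, Σ S : {S : Finset (Fin Λ) // S.card = τ i + 1}, Fin (S.1.sup (load U))

/-- The key bits of a user of the helper cache `l`: in each layer `i`, one bit for each set of
`τ i + 1` helper caches containing `l`. -/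
abbrev KeyPos (τ : ι → ℕ) (l : Fin Λ) : Type _ :=
  Σ i, {S : Finset (Fin Λ) // S.card = τ i + 1 ∧ l ∈ S}

/-- The broadcast bit at the set `S` that serves the user `k`. -/
def txPosOf {τ : ι → ℕ} (U : Association K Λ) (k : Fin K) (q : KeyPos τ (U k)) : TxPos τ U :=
  ⟨q.1, ⟨q.2.1, q.2.2.1⟩,
    ⟨rank U k, (rank_lt_load U k).trans_le (Finset.le_sup (f := load U) q.2.2.2)⟩⟩

end Positions

/-- An enumeration of all positions that occur in the layered scheme by initial segments of `ℕ`,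
which turns bits indexed by positions into bit strings. -/
structure Layout (N K Λ B : ℕ) {ι : Type*} (τ : ι → ℕ) (o : Fin Λ) where
  /-- the length of a helper cache -/
  helperLen : ℕ
  /-- the length of the broadcast -/
  txLen : Association K Λ → ℕ
  /-- the bits of a file -/
  file : FilePos τ o ≃ Fin B
  /-- the content of a helper cache -/
  helper : (l : Fin Λ) → Fin N × SharePos τ l ≃ Fin helperLen
  /-- the broadcast bits -/
  tx : (U : Association K Λ) → TxPos τ U ≃ Fin (txLen U)
  /-- the keys of a user of a helper cache -/
  key : (l : Fin Λ) → KeyPos τ l ≃ Fin B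

namespace Layout

variable {N K Λ B : ℕ} {ι : Type*} {τ : ι → ℕ} {o : Fin Λ} (E : Layout N K Λ B τ o)

/-- The share of the file `n` at the set `T` in the layer `i`. As the random bits `r T` of the
secret sharing are indexed by the sets containing `o`, the random bits of the placement are indexed
by the positions of the helper cache `o`, which consequently stores just them. -/
def shareBit (W : Fin N → Bits B) (ρ : Bits E.helperLen) (i : ι) (n : Fin N)
    (T : Finset (Fin Λ)) : Bool :=
  share o (extendZero fun T => W n (E.file ⟨i, T⟩)) (extendZero fun T => ρ (E.helper o (n, ⟨i, T⟩)))
    T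

theorem shareBit_add (W W' : Fin N → Bits B) (ρ ρ' : Bits E.helperLen) (i : ι) (n : Fin N)
    (T : Finset (Fin Λ)) :
    E.shareBit (W + W') (ρ + ρ') i n T = E.shareBit W ρ i n T + E.shareBit W' ρ' i n T := by
  rw [shareBit, shareBit, shareBit, ← share_add, ← extendZero_add, ← extendZero_add]
  rfl

/-- The sum of the shares for the users of a fixed rank in the caches of a set `S`: each of them
obtains the share of the file it requested at the set `S` without its own cache. -/
def payload (U : Association K Λ) (d : Demand K N) (W : Fin N → Bits B) (ρ : Bits E.helperLen)
    (p : TxPos τ U) : Bool :=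
  ∑ k ∈ Finset.univ.filter (fun k => U k ∈ p.2.1.1 ∧ rank U k = p.2.2),
    E.shareBit W ρ p.1 (d k) (p.2.1.1.erase (U k))

theorem payload_add (U : Association K Λ) (d : Demand K N) (W W' : Fin N → Bits B)
    (ρ ρ' : Bits E.helperLen) (p : TxPos τ U) :
    E.payload U d (W + W') (ρ + ρ') p = E.payload U d W ρ p + E.payload U d W' ρ' p := by
  simp only [payload, shareBit_add, Finset.sum_add_distrib]

/-- The scheme: every helper cache stores the shares at the sets containing it, and every broadcast
bit is a payload encrypted by a key bit known just to the users it serves. -/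
abbrev scheme : CachingScheme N K Λ B where
  helperRandLen := E.helperLen
  helperLen := E.helperLen
  helperCache l W ρ p :=
    let q := (E.helper l).symm p
    E.shareBit W ρ q.2.1 q.1 q.2.2
  keyRandLen := E.txLen
  userLen := B
  userCache U k κ p := κ (E.tx U (txPosOf U k ((E.key (U k)).symm p)))
  txLen := E.txLen
  transmit U d W ρ κ p := κ p + E.payload U d W ρ ((E.tx U).symm p)

variable (U : Association K Λ) (d : Demand K N) (k : Fin K)

/-- What user `k` observes is an additive function of the files and all random bits. -/
theorem observation_add (ω v : E.scheme.Sample U) :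
    (E.scheme.cached U k (ω + v), E.scheme.message U d (ω + v)) =
      (E.scheme.cached U k ω, E.scheme.message U d ω) +
        (E.scheme.cached U k v, E.scheme.message U d v) := by
  refine Prod.ext (Prod.ext ?_ ?_) ?_
  · funext p
    exact E.shareBit_add _ _ _ _ _ _ _
  · rfl
  · funext p
    refine (congrArg (ω.2.2 p + v.2.2 p + ·) (E.payload_add U d _ _ _ _ _)).trans ?_
    exact add_add_add_comm _ _ _ _

theorem cached_eq_zero_iff (W : Fin N → Bits B) (ρ : Bits E.helperLen) (κ : Bits (E.txLen U)) :
    E.scheme.cached U k (W, ρ, κ) = 0 ↔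
      (∀ (i : ι) (n : Fin N) (T : Finset (Fin Λ)), T.card = τ i → U k ∈ T →
        E.shareBit W ρ i n T = 0) ∧
      ∀ q : KeyPos τ (U k), κ (E.tx U (txPosOf U k q)) = 0 := by
  rw [Prod.ext_iff]
  refine and_congr ⟨fun h i n T hT hU => ?_, fun h => ?_⟩ ⟨fun h q => ?_, fun h => ?_⟩
  · let f : Fin N × SharePos τ (U k) → Bool := fun q => E.shareBit W ρ q.2.1 q.1 q.2.2
    have := congrFun h (E.helper (U k) (n, ⟨i, T, hT, hU⟩))
    change f ((E.helper (U k)).symm _) = 0 at this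
    rwa [Equiv.symm_apply_apply] at this
  · funext p
    exact h _ _ _ ((E.helper (U k)).symm p).2.2.2.1 ((E.helper (U k)).symm p).2.2.2.2
  · have := congrFun h (E.key (U k) q)
    change κ (E.tx U (txPosOf U k ((E.key (U k)).symm _))) = 0 at this
    rwa [Equiv.symm_apply_apply] at this
  · funext p
    exact h _

theorem message_eq_zero_iff (W : Fin N → Bits B) (ρ : Bits E.helperLen) (κ : Bits (E.txLen U)) :
    E.scheme.message U d (W, ρ, κ) = 0 ↔ ∀ p, κ (E.tx U p) + E.payload U d W ρ p = 0 := by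
  refine ⟨fun h p => ?_, fun h => funext fun p => ?_⟩
  · have := congrFun h (E.tx U p)
    change κ _ + E.payload U d W ρ ((E.tx U).symm _) = 0 at this
    rwa [Equiv.symm_apply_apply] at this
  · have := h ((E.tx U).symm p)
    rwa [Equiv.apply_symm_apply] at this

/-- If the shares at the sets containing its cache are zero, the payload serving a user reduces to
the share of the file it requested: the other users served have different caches. -/
theorem payload_txPosOf {W : Fin N → Bits B} {ρ : Bits E.helperLen}
    (h : ∀ (i : ι) (n : Fin N) (T : Finset (Fin Λ)), T.card = τ i → U k ∈ T →
      E.shareBit W ρ i n T = 0) (q : KeyPos τ (U k)) :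
    E.payload U d W ρ (txPosOf U k q) = E.shareBit W ρ q.1 (d k) (q.2.1.erase (U k)) := by
  refine Finset.sum_eq_single_of_mem k
    (Finset.mem_filter.2 ⟨Finset.mem_univ k, q.2.2.2, rfl⟩) fun k' hk' hne => ?_
  obtain ⟨-, hmem, hrank⟩ := Finset.mem_filter.1 hk'
  refine h _ _ _ ?_ (Finset.mem_erase.2 ⟨fun e => hne (eq_of_rank_eq U e.symm hrank), q.2.2.2⟩)
  exact (Finset.card_erase_of_mem hmem).trans (Nat.sub_eq_of_eq_add q.2.2.1)

theorem correct_scheme : E.scheme.Correct := by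
  intro U d k
  refine exists_factor_of_ker_le (X := fun ω : E.scheme.Sample U => ω.1 (d k))
    (fun _ _ => rfl) (E.observation_add U d k) fun ⟨W, ρ, κ⟩ hv => ?_
  rw [Prod.mk_eq_zero, cached_eq_zero_iff, message_eq_zero_iff] at hv
  obtain ⟨⟨hhelper, hkey⟩, hmsg⟩ := hv
  have hshare : ∀ (i : ι) (T : Finset (Fin Λ)), T.card = τ i →
      E.shareBit W ρ i (d k) T = 0 := by
    intro i T hT
    by_cases hU : U k ∈ T
    · exact hhelper i (d k) T hT hU
    · let q : KeyPos τ (U k) := ⟨i, insert (U k) T,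
        by rw [Finset.card_insert_of_notMem hU, hT], Finset.mem_insert_self _ _⟩
      have := hmsg (txPosOf U k q)
      rwa [hkey, zero_add, E.payload_txPosOf U d k hhelper, Finset.erase_insert hU] at this
  funext b
  obtain ⟨⟨i, T⟩, rfl⟩ := E.file.surjective b
  have := eq_zero_of_share_eq_zero (hshare i) T.2.1 T.2.2
  rwa [extendZero_of_pos _ T.2] at this

theorem perfectlySecret_scheme [Finite ι] : E.scheme.PerfectlySecret := by
  intro U d k
  refine mutualInfo_uniformOn_eq_zero (fun _ _ => rfl) (E.observation_add U d k) fun a => ?_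
  let W : Fin N → Bits B := fun n => if h : n ≠ d k then a ⟨n, h⟩ else 0
  -- The random bits that make all shares in the helper cache of user `k` vanish.
  let g : Fin N × SharePos τ o → Bool := fun q =>
    if U k ∈ q.2.2.1 then 0
    else extendZero (fun T => W q.1 (E.file ⟨q.2.1, T⟩)) (insert (U k) (q.2.2.1.erase o))
  let ρ : Bits E.helperLen := fun p => g ((E.helper o).symm p)
  -- The key bits cancel the payloads, so that nothing is broadcast.
  let κ : Bits (E.txLen U) := fun p => E.payload U d W ρ ((E.tx U).symm p)
  have hhelper : ∀ (i : ι) (n : Fin N) (T : Finset (Fin Λ)), T.card = τ i → U k ∈ T →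
      E.shareBit W ρ i n T = 0 := by
    intro i n T hT hU
    refine share_eq_zero_of_mem (t := τ i) (fun T hT ho => ?_) hT hU
    rw [extendZero_of_pos _ ⟨hT, ho⟩]
    exact congrArg g ((E.helper o).symm_apply_apply _)
  -- The file requested by user `k` is zero, hence so are all its shares and the keys of user `k`.
  have hzero : ∀ (i : ι) (T : Finset (Fin Λ)), T.card = τ i → E.shareBit W ρ i (d k) T = 0 := by
    intro i T hT
    have hW : W (d k) = 0 := by simp [W]
    have hw : (extendZero fun T => W (d k) (E.file ⟨i, T⟩)) = 0 := by
      funext T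
      simp [extendZero, hW]
    have hr : (extendZero fun T => ρ (E.helper o (d k, ⟨i, T⟩))) = 0 := by
      funext T
      simp [extendZero, hW, ρ, g]
    simp [shareBit, share, hw, hr]
  refine ⟨(W, ρ, κ), ?_, ?_⟩
  · funext n
    simp [W, n.2]
  · rw [Prod.mk_eq_zero, cached_eq_zero_iff, message_eq_zero_iff]
    refine ⟨⟨hhelper, fun q => ?_⟩, fun p => ?_⟩
    · simp only [κ, Equiv.symm_apply_apply]
      rw [E.payload_txPosOf U d k hhelper]
      refine hzero _ _ ?_
      rw [Finset.card_erase_of_mem q.2.2.2, q.2.2.1, Nat.add_sub_cancel]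
    · simp only [κ, Equiv.symm_apply_apply]
      generalize E.payload U d W ρ p = b
      cases b <;> rfl

end Layout

/-! ### Counting positions -/

section Counting

variable {n : ℕ}

theorem card_filter_card_eq_notMem (t : ℕ) (l : Fin n) :
    (Finset.univ.filter fun T : Finset (Fin n) => T.card = t ∧ l ∉ T).card = (n - 1).choose t := by
  have : (Finset.univ.filter fun T : Finset (Fin n) => T.card = t ∧ l ∉ T) =
      Finset.powersetCard t (Finset.univ.erase l) := by
    ext T
    simp only [Finset.mem_filter, Finset.mem_univ, true_and, Finset.mem_powersetCard,
      Finset.subset_erase, Finset.subset_univ]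
    exact and_comm
  rw [this, Finset.card_powersetCard, Finset.card_erase_of_mem (Finset.mem_univ l),
    Finset.card_univ, Fintype.card_fin]

theorem card_filter_card_eq_mem (t : ℕ) (l : Fin n) :
    (Finset.univ.filter fun T : Finset (Fin n) => T.card = t ∧ l ∈ T).card =
      n.choose t - (n - 1).choose t := by
  have h := Finset.card_filter_add_card_filter_not
    (s := Finset.powersetCard t (Finset.univ : Finset (Fin n))) (fun T => l ∈ T)
  have h' := card_filter_card_eq_notMem t l
  rw [Finset.card_powersetCard, Finset.card_univ, Fintype.card_fin,
    Finset.powersetCard_eq_filter, Finset.powerset_univ, Finset.filter_filter,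
    Finset.filter_filter] at h
  omega

theorem card_filter_card_eq_succ_mem (t : ℕ) (l : Fin n) :
    (Finset.univ.filter fun T : Finset (Fin n) => T.card = t + 1 ∧ l ∈ T).card =
      (n - 1).choose t := by
  have := l.pos
  obtain ⟨m, rfl⟩ : ∃ m, n = m + 1 := ⟨n - 1, by omega⟩
  rw [card_filter_card_eq_mem, Nat.choose_succ_succ, Nat.add_sub_cancel, Nat.add_sub_cancel]

theorem card_filter_card_eq_min (t : ℕ) (r : Fin n) :
    ((Finset.powersetCard (t + 1) Finset.univ).filter
      fun S : Finset (Fin n) => r ∈ S ∧ ∀ x ∈ S, r ≤ x).card = (n - (r + 1)).choose t := by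
  have h : (Finset.powersetCard t (Finset.Ioi r)).card = (n - (r + 1)).choose t := by
    rw [Finset.card_powersetCard, Fin.card_Ioi, Nat.sub_sub, add_comm 1]
  rw [← h]
  refine Finset.card_nbij' (fun S => S.erase r) (fun T => insert r T) ?_ ?_ ?_ ?_
  · intro S hS
    simp only [Finset.coe_filter, Finset.mem_powersetCard, Finset.subset_univ, true_and,
      Set.mem_ofPred_eq] at hS
    simp only [Finset.mem_coe, Finset.mem_powersetCard]
    refine ⟨fun x hx => Finset.mem_Ioi.2 ?_, ?_⟩
    · exact lt_of_le_of_ne (hS.2.2 x (Finset.mem_of_mem_erase hx)) (Finset.ne_of_mem_erase hx).symm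
    · rw [Finset.card_erase_of_mem hS.2.1, hS.1, Nat.add_sub_cancel]
  · intro T hT
    simp only [Finset.mem_coe, Finset.mem_powersetCard] at hT
    have hr : r ∉ T := fun h => lt_irrefl r (Finset.mem_Ioi.1 (hT.1 h))
    simp only [Finset.coe_filter, Finset.mem_powersetCard, Finset.subset_univ, true_and,
      Set.mem_ofPred_eq]
    refine ⟨by rw [Finset.card_insert_of_notMem hr, hT.2], Finset.mem_insert_self _ _, ?_⟩
    intro x hx
    rcases Finset.mem_insert.1 hx with rfl | hx
    · exact le_rfl
    · exact (Finset.mem_Ioi.1 (hT.1 hx)).le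
  · intro S hS
    exact Finset.insert_erase (Finset.mem_filter.1 hS).2.1
  · intro T hT
    simp only [Finset.mem_coe, Finset.mem_powersetCard] at hT
    exact Finset.erase_insert fun h => lt_irrefl r (Finset.mem_Ioi.1 (hT.1 h))

/-- The sets `S` are counted by their least element, where the antitone function `L` attains its
maximum over `S`. -/
theorem sum_powersetCard_sup (t : ℕ) {L : Fin n → ℕ} (hL : Antitone L) :
    ∑ S ∈ Finset.powersetCard (t + 1) (Finset.univ : Finset (Fin n)), S.sup L =
      ∑ r : Fin n, L r * (n - (r + 1)).choose t := by
  have hS : ∀ S ∈ Finset.powersetCard (t + 1) (Finset.univ : Finset (Fin n)),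
      S.sup L = ∑ r : Fin n, if r ∈ S ∧ ∀ x ∈ S, r ≤ x then L r else 0 := by
    intro S hS
    have hne : S.Nonempty := Finset.card_pos.1 (by rw [(Finset.mem_powersetCard.1 hS).2]; omega)
    rw [Finset.sum_eq_single (S.min' hne)]
    · rw [if_pos ⟨S.min'_mem hne, fun x hx => S.min'_le x hx⟩]
      exact le_antisymm (Finset.sup_le fun x hx => hL (S.min'_le x hx))
        (Finset.le_sup (S.min'_mem hne))
    · intro r _ hr
      exact if_neg fun h => hr (le_antisymm (h.2 _ (S.min'_mem hne)) (S.min'_le r h.1))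
    · simp
  rw [Finset.sum_congr rfl hS, Finset.sum_comm]
  refine Finset.sum_congr rfl fun r _ => ?_
  rw [← Finset.sum_filter, Finset.sum_const, card_filter_card_eq_min, smul_eq_mul, mul_comm]

end Counting

/-- The number of broadcast bits in a single layer depends on the profile only. -/
theorem sum_powersetCard_sup_load {K Λ : ℕ} (t : ℕ) {U : Association K Λ} {L : Fin Λ → ℕ}
    (h : HasProfile U L) :
    ∑ S ∈ Finset.powersetCard (t + 1) (Finset.univ : Finset (Fin Λ)), S.sup (load U) =
      ∑ r : Fin Λ, L r * (Λ - (r + 1)).choose t := by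
  obtain ⟨hL, σ, hσ⟩ := h
  rw [← sum_powersetCard_sup t hL]
  symm
  refine Finset.sum_equiv σ.finsetCongr (fun S => by simp) fun S _ => ?_
  rw [Equiv.finsetCongr_apply, Finset.sup_map]
  exact Finset.sup_congr rfl fun r _ => (hσ r).symm

theorem secretiveRate_mul_choose {Λ t : ℕ} (ht : t < Λ) (L : Fin Λ → ℕ) :
    secretiveRate Λ t L * ((Λ - 1).choose t : ℝ) =
      ∑ r : Fin Λ, (L r : ℝ) * ((Λ - (r + 1)).choose t : ℝ) := by
  have hpos : 0 < (Λ - 1).choose t := Nat.choose_pos (by omega)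
  rw [secretiveRate, div_mul_cancel₀ _ (by positivity), Finset.sum_filter]
  refine Finset.sum_congr rfl fun r _ => ?_
  split_ifs with h
  · rfl
  · rw [Nat.choose_eq_zero_of_lt (by omega), Nat.cast_zero, mul_zero]

theorem exists_layeredScheme (N K : ℕ) {Λ : ℕ} (hΛ : 1 ≤ Λ) {ι : Type*} [Fintype ι] (τ : ι → ℕ)
    (hτ : ∀ i, τ i < Λ) {B : ℕ} (hB : B = ∑ i, (Λ - 1).choose (τ i)) :
    ∃ S : CachingScheme N K Λ B, S.Correct ∧ S.PerfectlySecret ∧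
      S.helperLen = N * ∑ i, (Λ.choose (τ i) - (Λ - 1).choose (τ i)) ∧ S.userLen = B ∧
      ∀ (U : Association K Λ) (L : Fin Λ → ℕ), HasProfile U L →
        (S.txLen U : ℝ) = ∑ i, secretiveRate Λ (τ i) L * ((Λ - 1).choose (τ i) : ℝ) := by
  let o : Fin Λ := ⟨0, hΛ⟩
  let E : Layout N K Λ B τ o :=
    { helperLen := N * ∑ i, (Λ.choose (τ i) - (Λ - 1).choose (τ i))
      txLen := fun U =>
        ∑ i, ∑ S ∈ Finset.powersetCard (τ i + 1) (Finset.univ : Finset (Fin Λ)), S.sup (load U)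
      file := Fintype.equivFinOfCardEq (by
        simp only [Fintype.card_sigma, Fintype.card_subtype, card_filter_card_eq_notMem, hB])
      helper := fun l => Fintype.equivFinOfCardEq (by
        simp only [Fintype.card_prod, Fintype.card_fin, Fintype.card_sigma, Fintype.card_subtype,
          card_filter_card_eq_mem])
      tx := fun U => Fintype.equivFinOfCardEq (by
        simp only [Fintype.card_fin, Fintype.card_sigma]
        refine Finset.sum_congr rfl fun i _ => ?_
        refine (Finset.sum_subtype _ ?_ fun S : Finset (Fin Λ) => S.sup (load U)).symm
        simp)
      key := fun l => Fintype.equivFinOfCardEq (by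
        simp only [Fintype.card_sigma, Fintype.card_subtype, card_filter_card_eq_succ_mem, hB]) }
  refine ⟨E.scheme, E.correct_scheme, E.perfectlySecret_scheme, rfl, rfl, fun U L hL => ?_⟩
  change ((∑ i, ∑ S ∈ Finset.powersetCard (τ i + 1) (Finset.univ : Finset (Fin Λ)),
    S.sup (load U) : ℕ) : ℝ) = _
  rw [Nat.cast_sum]
  refine Finset.sum_congr rfl fun i _ => ?_
  rw [sum_powersetCard_sup_load _ hL, secretiveRate_mul_choose (hτ i)]
  push_cast
  rfl

/-! ### Convexity of the memory-rate points -/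

/-- If the slopes `g j` of consecutive points `(m j, R j)` increase, then no point lies below the
line through two consecutive points. -/
theorem line_le_of_slope_mono {m R g : ℕ → ℝ} {n : ℕ} (hm : ∀ j, j + 1 < n → m j ≤ m (j + 1))
    (hR : ∀ j, j + 1 < n → R (j + 1) - R j = g j * (m (j + 1) - m j))
    (hg : ∀ i j, i ≤ j → j + 1 < n → g i ≤ g j) {t : ℕ} (ht : t + 1 < n) {v : ℕ} (hv : v < n) :
    R t + g t * (m v - m t) ≤ R v := by
  rcases le_total t v with h | h
  · induction v, h using Nat.le_induction with
    | base => simp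
    | succ v h ih =>
      have := mul_le_mul_of_nonneg_right (hg t v h hv) (sub_nonneg.2 (hm v hv))
      linarith [ih (by omega), hR v hv]
  · obtain ⟨k, rfl⟩ := Nat.exists_eq_add_of_le h
    clear h
    induction k generalizing v with
    | zero => simp
    | succ k ih =>
      have e : v + (k + 1) = v + 1 + k := by omega
      rw [e] at ht ⊢
      have := mul_le_mul_of_nonneg_right (hg v (v + 1 + k) (by omega) ht)
        (sub_nonneg.2 (hm v (by omega)))
      linarith [ih (v := v + 1) (by omega) (by omega), hR v (by omega)]

/-- The helper cache size `M` at which `Λ M / (M + N)` equals `t`. -/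
noncomputable def cornerMemory (N Λ t : ℕ) : ℝ := (N : ℝ) * t / ((Λ : ℝ) - t)

theorem eq_cornerMemory {N Λ t : ℕ} (hN : 0 < N) {M : ℝ} (hM : 0 ≤ M) (ht : t < Λ)
    (h : (t : ℝ) = (Λ : ℝ) * M / (M + (N : ℝ))) : M = cornerMemory N Λ t := by
  have hN' : (0 : ℝ) < N := by exact_mod_cast hN
  have ht' : (t : ℝ) < Λ := by exact_mod_cast ht
  rw [eq_div_iff (by positivity)] at h
  rw [cornerMemory, eq_div_iff (sub_pos.2 ht').ne']
  linarith

theorem cornerMemory_mem_cornerPoints {N Λ t : ℕ} (hN : 0 < N) (ht : t < Λ) (L : Fin Λ → ℕ) :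
    (cornerMemory N Λ t, secretiveRate Λ t L) ∈ cornerPoints N Λ L := by
  have hN' : (0 : ℝ) < N := by exact_mod_cast hN
  have ht' : (0 : ℝ) < (Λ : ℝ) - t := sub_pos.2 (by exact_mod_cast ht)
  have hΛ : (0 : ℝ) < Λ := by exact_mod_cast (Nat.zero_le t).trans_lt ht
  have h0 : 0 ≤ cornerMemory N Λ t := by unfold cornerMemory; positivity
  refine ⟨h0, t, ht, ?_, rfl⟩
  have h1 : cornerMemory N Λ t * ((Λ : ℝ) - t) = N * t := div_mul_cancel₀ _ ht'.ne'
  rw [eq_div_iff (by positivity)]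
  change (t : ℝ) * (cornerMemory N Λ t + N) = Λ * cornerMemory N Λ t
  linarith

theorem cornerMemory_succ_sub {N Λ t : ℕ} (ht : t + 1 < Λ) :
    cornerMemory N Λ (t + 1) - cornerMemory N Λ t =
      (N * Λ : ℝ) / (((Λ : ℝ) - t) * ((Λ : ℝ) - t - 1)) := by
  have ht' : (t : ℝ) + 1 < Λ := by exact_mod_cast ht
  have h1 : (Λ : ℝ) - t ≠ 0 := by linarith
  have h2 : (Λ : ℝ) - t - 1 ≠ 0 := by linarith
  have h3 : (Λ : ℝ) - (t + 1) ≠ 0 := by linarith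
  unfold cornerMemory
  push_cast
  field_simp
  ring

theorem cornerMemory_lt_succ {N Λ t : ℕ} (hN : 0 < N) (ht : t + 1 < Λ) :
    cornerMemory N Λ t < cornerMemory N Λ (t + 1) := by
  have hN' : (0 : ℝ) < N := by exact_mod_cast hN
  have ht' : (t : ℝ) + 1 < Λ := by exact_mod_cast ht
  have hΛ : (0 : ℝ) < Λ := by linarith [t.cast_nonneg (α := ℝ)]
  rw [← sub_pos, cornerMemory_succ_sub ht]
  exact div_pos (by positivity) (mul_pos (by linarith) (by linarith))

/-- The shares stored in a helper cache take up the available memory exactly. -/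
theorem mul_choose_sub_choose {N Λ t : ℕ} (ht : t < Λ) :
    (N : ℝ) * ((Λ.choose t - (Λ - 1).choose t : ℕ) : ℝ) =
      cornerMemory N Λ t * ((Λ - 1).choose t : ℝ) := by
  obtain ⟨a, rfl⟩ : ∃ a, Λ = a + 1 := ⟨Λ - 1, by omega⟩
  rw [Nat.add_sub_cancel, Nat.cast_sub (Nat.choose_le_succ a t)]
  have h : (a.choose t : ℝ) * (a + 1) = (a + 1).choose t * (a + 1 - t) := by
    have := Nat.choose_mul_succ_eq a t
    rw [← Nat.cast_inj (R := ℝ)] at this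
    push_cast [Nat.cast_sub ht.le] at this
    exact this
  have ht' : (t : ℝ) < (a + 1 : ℕ) := by exact_mod_cast ht
  have hne : ((a + 1 : ℕ) : ℝ) - t ≠ 0 := by linarith
  rw [cornerMemory, div_mul_eq_mul_div, eq_div_iff hne]
  push_cast
  linear_combination -(N : ℝ) * h

/-- In this form of the rate, the parameter `t` occurs in the numerators only. -/
theorem secretiveRate_eq_sum {Λ t : ℕ} (ht : t < Λ) (L : Fin Λ → ℕ) :
    secretiveRate Λ t L =
      ∑ r : Fin Λ, (L r : ℝ) / ((Λ - 1).choose r : ℝ) * ((Λ - 1 - t).choose r : ℝ) := by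
  have hpos : (0 : ℝ) < (Λ - 1).choose t := by exact_mod_cast Nat.choose_pos (by omega)
  rw [← mul_left_inj' hpos.ne', secretiveRate_mul_choose ht, Finset.sum_mul]
  refine Finset.sum_congr rfl fun r _ => ?_
  have hr : (0 : ℝ) < (Λ - 1).choose r := by exact_mod_cast Nat.choose_pos (by omega)
  have h : (Λ - 1).choose r * (Λ - (r + 1)).choose t =
      (Λ - 1).choose t * (Λ - 1 - t).choose r := by
    have h1 := Nat.choose_mul (n := Λ - 1) (k := t + r) (s := t) (by omega)
    have h2 := Nat.choose_mul (n := Λ - 1) (k := t + r) (s := r) (by omega)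
    rw [Nat.add_sub_cancel_left] at h1
    rw [Nat.add_sub_cancel, ← Nat.choose_symm_add, h1] at h2
    rw [h2, Nat.sub_sub, add_comm 1]
  have h' : ((Λ - 1).choose r : ℝ) * (Λ - (r + 1)).choose t =
      (Λ - 1).choose t * (Λ - 1 - t).choose r := by exact_mod_cast h
  field_simp
  linear_combination (L r : ℝ) * h'

/-- The decrease of a binomial coefficient `C(a - t, r)` from `t` to `t + 1`, as a real number. -/
def chooseDrop (a r t : ℕ) : ℝ := ((a - t).choose r : ℝ) - ((a - (t + 1)).choose r : ℝ)

theorem chooseDrop_nonneg (a r t : ℕ) : 0 ≤ chooseDrop a r t :=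
  sub_nonneg.2 (by exact_mod_cast Nat.choose_le_choose r (by omega))

theorem chooseDrop_anti {a r i j : ℕ} (hij : i ≤ j) (hj : j < a) :
    chooseDrop a r j ≤ chooseDrop a r i := by
  have key : ∀ k, k < a → chooseDrop a r k = if r = 0 then 0 else
      ((a - (k + 1)).choose (r - 1) : ℝ) := by
    intro k hk
    rcases r with _ | r
    · simp [chooseDrop]
    · obtain ⟨b, hb⟩ : ∃ b, a - k = b + 1 := ⟨a - k - 1, by omega⟩
      have hb' : a - (k + 1) = b := by omega
      rw [chooseDrop, hb, hb', Nat.choose_succ_succ]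
      simp
  rw [key j hj, key i (by omega)]
  split_ifs
  · exact le_rfl
  · exact_mod_cast Nat.choose_le_choose _ (by omega)

theorem secretiveRate_succ_sub {Λ t : ℕ} (ht : t + 1 < Λ) (L : Fin Λ → ℕ) :
    secretiveRate Λ (t + 1) L - secretiveRate Λ t L =
      -∑ r : Fin Λ, (L r : ℝ) / ((Λ - 1).choose r : ℝ) * chooseDrop (Λ - 1) r t := by
  rw [secretiveRate_eq_sum ht, secretiveRate_eq_sum (by omega), ← Finset.sum_sub_distrib,
    ← Finset.sum_neg_distrib]
  refine Finset.sum_congr rfl fun r _ => ?_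
  rw [chooseDrop]
  ring

theorem secretiveRate_succ_le {Λ t : ℕ} (ht : t + 1 < Λ) (L : Fin Λ → ℕ) :
    secretiveRate Λ (t + 1) L ≤ secretiveRate Λ t L := by
  rw [← sub_nonpos, secretiveRate_succ_sub ht, neg_nonpos]
  exact Finset.sum_nonneg fun r _ => mul_nonneg (by positivity) (chooseDrop_nonneg _ _ _)

theorem secretiveRate_nonneg (Λ t : ℕ) (L : Fin Λ → ℕ) : 0 ≤ secretiveRate Λ t L := by
  unfold secretiveRate
  positivity

theorem secretiveRate_le {K Λ t : ℕ} (ht : t < Λ) {L : Fin Λ → ℕ} (hL : ∀ r, L r ≤ K) :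
    secretiveRate Λ t L ≤ Λ * K := by
  rw [secretiveRate_eq_sum ht]
  calc _ ≤ ∑ _r : Fin Λ, (K : ℝ) := Finset.sum_le_sum fun r _ => ?_
    _ = Λ * K := by simp
  have hr : (0 : ℝ) < (Λ - 1).choose r := by exact_mod_cast Nat.choose_pos (by omega)
  have h1 : ((Λ - 1 - t).choose r : ℝ) ≤ (Λ - 1).choose r := by
    exact_mod_cast Nat.choose_le_choose _ (by omega)
  have h2 : (L r : ℝ) ≤ K := by exact_mod_cast hL r
  rw [div_mul_eq_mul_div, div_le_iff₀ hr]
  exact mul_le_mul h2 h1 (by positivity) (by positivity)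

/-- The memory-rate points are in convex position: none of them lies below the line through two
consecutive ones. The slope is minus a product of two nonnegative factors that decrease with `t`. -/
theorem exists_line_le_secretiveRate {N Λ t : ℕ} (hN : 0 < N) (ht : t + 1 < Λ) (L : Fin Λ → ℕ) :
    ∃ g : ℝ, secretiveRate Λ (t + 1) L - secretiveRate Λ t L =
        g * (cornerMemory N Λ (t + 1) - cornerMemory N Λ t) ∧
      ∀ v < Λ, secretiveRate Λ t L + g * (cornerMemory N Λ v - cornerMemory N Λ t) ≤
        secretiveRate Λ v L := by
  have hN' : (0 : ℝ) < N := by exact_mod_cast hN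
  have hΛ : (0 : ℝ) < Λ := by exact_mod_cast (Nat.zero_le _).trans_lt ht
  let c : Fin Λ → ℝ := fun r => (L r : ℝ) / ((Λ - 1).choose r : ℝ)
  have hc : ∀ r, 0 ≤ c r := fun r => by positivity
  let g : ℕ → ℝ := fun j => -((∑ r : Fin Λ, c r * chooseDrop (Λ - 1) r j) *
    ((((Λ : ℝ) - j) * ((Λ : ℝ) - j - 1)) / (N * Λ)))
  have hR : ∀ j, j + 1 < Λ → secretiveRate Λ (j + 1) L - secretiveRate Λ j L =
      g j * (cornerMemory N Λ (j + 1) - cornerMemory N Λ j) := by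
    intro j hj
    have hj' : (j : ℝ) + 1 < Λ := by exact_mod_cast hj
    have h1 : (Λ : ℝ) - j ≠ 0 := by linarith
    have h2 : (Λ : ℝ) - j - 1 ≠ 0 := by linarith
    rw [secretiveRate_succ_sub hj, cornerMemory_succ_sub hj, neg_mul, mul_assoc,
      div_mul_div_cancel₀ (by positivity), div_self (mul_ne_zero h1 h2), mul_one]
  have hg : ∀ i j, i ≤ j → j + 1 < Λ → g i ≤ g j := by
    intro i j hij hj
    have hj' : (j : ℝ) + 1 < Λ := by exact_mod_cast hj
    have hij' : (i : ℝ) ≤ j := by exact_mod_cast hij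
    refine neg_le_neg (mul_le_mul ?_ ?_ ?_ ?_)
    · exact Finset.sum_le_sum fun r _ =>
        mul_le_mul_of_nonneg_left (chooseDrop_anti hij (by omega)) (hc r)
    · refine div_le_div_of_nonneg_right ?_ (by positivity)
      exact mul_le_mul (by linarith) (by linarith) (by linarith) (by linarith)
    · exact div_nonneg (mul_nonneg (by linarith) (by linarith)) (by positivity)
    · exact Finset.sum_nonneg fun r _ => mul_nonneg (hc r) (chooseDrop_nonneg _ _ _)
  exact ⟨g t, hR t ht, fun v hv => line_le_of_slope_mono
    (m := cornerMemory N Λ) (R := fun j => secretiveRate Λ j L)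
    (fun j hj => (cornerMemory_lt_succ hN hj).le) hR hg ht hv⟩

/-- A line below all points of `P` is below the lower convex envelope wherever some point of the
convex hull witnesses that the envelope is not the infimum of the empty set. -/
theorem line_le_lowerConvexEnvelope {P : Set (ℝ × ℝ)} {a g x y : ℝ}
    (h : ∀ p ∈ P, a + g * p.1 ≤ p.2) (hy : (x, y) ∈ convexHull ℝ P) :
    a + g * x ≤ lowerConvexEnvelope P x := by
  refine le_csInf ⟨y, hy⟩ fun z hz => ?_
  have hconv : Convex ℝ {p : ℝ × ℝ | a + g * p.1 ≤ p.2} := by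
    intro p hp q hq α β hα hβ hαβ
    have h1 := mul_le_mul_of_nonneg_left (show a + g * p.1 ≤ p.2 from hp) hα
    have h2 := mul_le_mul_of_nonneg_left (show a + g * q.1 ≤ q.2 from hq) hβ
    change a + g * (α * p.1 + β * q.1) ≤ α * p.2 + β * q.2
    have h3 : a = α * a + β * a := by rw [← add_mul, hαβ, one_mul]
    linarith
  exact convexHull_min (fun p hp => h p hp) hconv hz

theorem le_card_of_hasProfile {K Λ : ℕ} {U : Association K Λ} {L : Fin Λ → ℕ}
    (h : HasProfile U L) (r : Fin Λ) : L r ≤ K := by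
  obtain ⟨-, σ, hσ⟩ := h
  rw [← hσ r]
  exact (Finset.card_le_univ _).trans_eq (Fintype.card_fin K)

theorem exists_le_le_succ {f : ℕ → ℝ} {x : ℝ} (h0 : f 0 ≤ x) (n : ℕ) (hn : x ≤ f (n + 1)) :
    ∃ t ≤ n, f t ≤ x ∧ x ≤ f (t + 1) := by
  induction n with
  | zero => exact ⟨0, le_rfl, h0, hn⟩
  | succ n ih =>
    rcases le_total x (f (n + 1)) with h | h
    · obtain ⟨t, ht, h'⟩ := ih h
      exact ⟨t, by omega, h'⟩
    · exact ⟨n + 1, le_rfl, h, hn⟩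

/-! ### Achievability -/

/-- The points at which `t` is an integer: all layers use the same `t`. -/
theorem exists_cornerScheme {N K Λ : ℕ} (hΛ : 1 ≤ Λ) {t : ℕ} (ht : t < Λ) :
    ∃ B₁ : ℕ, 0 < B₁ ∧ ∀ B : ℕ, 0 < B → B₁ ∣ B →
      ∃ S : CachingScheme N K Λ B, S.Correct ∧ S.PerfectlySecret ∧
        (S.helperLen : ℝ) ≤ cornerMemory N Λ t * (B : ℝ) ∧ S.userLen ≤ B ∧
        ∀ (U : Association K Λ) (L : Fin Λ → ℕ), HasProfile U L →
          (S.txLen U : ℝ) = secretiveRate Λ t L * (B : ℝ) := by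
  refine ⟨(Λ - 1).choose t, Nat.choose_pos (by omega), fun B _ hdvd => ?_⟩
  obtain ⟨c, rfl⟩ := hdvd
  obtain ⟨S, hS, hS', hlen, huser, htx⟩ := exists_layeredScheme N K hΛ (fun _ : Fin c => t)
    (fun _ => ht) (B := (Λ - 1).choose t * c) (by simp [mul_comm])
  refine ⟨S, hS, hS', le_of_eq ?_, huser.le, fun U L hL => ?_⟩
  · have := mul_choose_sub_choose (N := N) ht
    rw [hlen, Finset.sum_const, Finset.card_univ, Fintype.card_fin, smul_eq_mul]
    push_cast
    linear_combination (c : ℝ) * this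
  · rw [htx U L hL, Finset.sum_const, Finset.card_univ, Fintype.card_fin, nsmul_eq_mul]
    push_cast
    ring

/-- Memory sharing: a fraction `p / q` of each file is served with the parameter `t + 1` and the
rest with the parameter `t`. -/
theorem exists_mixedScheme {N K Λ : ℕ} (hΛ : 1 ≤ Λ) {t : ℕ} (ht : t + 1 < Λ) {p q : ℕ}
    (hpq : p ≤ q) (hq : 0 < q) :
    ∃ B₁ : ℕ, 0 < B₁ ∧ ∀ B : ℕ, 0 < B → B₁ ∣ B →
      ∃ S : CachingScheme N K Λ B, S.Correct ∧ S.PerfectlySecret ∧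
        (q * S.helperLen : ℝ) =
          ((q - p) * cornerMemory N Λ t + p * cornerMemory N Λ (t + 1)) * (B : ℝ) ∧
        S.userLen ≤ B ∧
        ∀ (U : Association K Λ) (L : Fin Λ → ℕ), HasProfile U L →
          (q * S.txLen U : ℝ) =
            ((q - p) * secretiveRate Λ t L + p * secretiveRate Λ (t + 1) L) * (B : ℝ) := by
  obtain ⟨s, rfl⟩ := Nat.exists_eq_add_of_le hpq
  have h₀ : 0 < (Λ - 1).choose t := Nat.choose_pos (by omega)
  have h₁ : 0 < (Λ - 1).choose (t + 1) := Nat.choose_pos (by omega)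
  refine ⟨(p + s) * ((Λ - 1).choose t * (Λ - 1).choose (t + 1)), by positivity,
    fun B _ hdvd => ?_⟩
  obtain ⟨c, rfl⟩ := hdvd
  let τ : Fin (s * c * (Λ - 1).choose (t + 1)) ⊕ Fin (p * c * (Λ - 1).choose t) → ℕ :=
    Sum.elim (fun _ => t) (fun _ => t + 1)
  obtain ⟨S, hS, hS', hlen, huser, htx⟩ := exists_layeredScheme N K hΛ τ
    (by rintro (i | i) <;> simp only [τ, Sum.elim_inl, Sum.elim_inr] <;> omega)
    (B := (p + s) * ((Λ - 1).choose t * (Λ - 1).choose (t + 1)) * c)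
    (by simp only [τ, Fintype.sum_sum_type, Sum.elim_inl, Sum.elim_inr, Finset.sum_const,
          Finset.card_univ, Fintype.card_fin, smul_eq_mul]
        ring)
  refine ⟨S, hS, hS', ?_, huser.le, fun U L hL => ?_⟩
  · have e₀ := mul_choose_sub_choose (N := N) (show t < Λ by omega)
    have e₁ := mul_choose_sub_choose (N := N) ht
    rw [hlen]
    simp only [τ, Fintype.sum_sum_type, Sum.elim_inl, Sum.elim_inr, Finset.sum_const,
      Finset.card_univ, Fintype.card_fin, smul_eq_mul]
    push_cast
    linear_combination ((p : ℝ) + s) * s * c * (Λ - 1).choose (t + 1) * e₀ +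
      ((p : ℝ) + s) * p * c * (Λ - 1).choose t * e₁
  · rw [htx U L hL]
    simp only [τ, Fintype.sum_sum_type, Sum.elim_inl, Sum.elim_inr, Finset.sum_const,
      Finset.card_univ, Fintype.card_fin, nsmul_eq_mul]
    push_cast
    ring

/-- Between two consecutive memory-rate points, memory sharing with a rational approximation from
below of the sharing ratio reaches the lower convex envelope up to `ε`. -/
theorem exists_envelopeScheme {N K Λ : ℕ} (hN : 0 < N) (hΛ : 1 ≤ Λ) {t : ℕ} (ht : t + 1 < Λ)
    {M : ℝ} (hM : cornerMemory N Λ t ≤ M) (hM' : M ≤ cornerMemory N Λ (t + 1)) {ε : ℝ}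
    (hε : 0 < ε) :
    ∃ B₁ : ℕ, 0 < B₁ ∧ ∀ B : ℕ, 0 < B → B₁ ∣ B →
      ∃ S : CachingScheme N K Λ B, S.Correct ∧ S.PerfectlySecret ∧
        (S.helperLen : ℝ) ≤ M * (B : ℝ) ∧ S.userLen ≤ B ∧
        ∀ (U : Association K Λ) (L : Fin Λ → ℕ), HasProfile U L →
          (S.txLen U : ℝ) ≤ (lowerConvexEnvelope (cornerPoints N Λ L) M + ε) * (B : ℝ) := by
  set m := cornerMemory N Λ with hm
  have hlt : 0 < m (t + 1) - m t := sub_pos.2 (cornerMemory_lt_succ hN ht)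
  obtain ⟨θ, hθ₀, hθ₁, hθ⟩ : ∃ θ : ℝ, 0 ≤ θ ∧ θ ≤ 1 ∧ M - m t = θ * (m (t + 1) - m t) :=
    ⟨(M - m t) / (m (t + 1) - m t), div_nonneg (by linarith) hlt.le,
      (div_le_one hlt).2 (by linarith), (div_mul_cancel₀ _ hlt.ne').symm⟩
  -- No rate exceeds `Λ K`, so that a rounding error of `1 / q` in the ratio costs at most `ε`.
  obtain ⟨q, hq⟩ := exists_nat_gt ((Λ * K : ℝ) / ε)
  have hq₀ : (0 : ℝ) < q := lt_of_le_of_lt (by positivity) hq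
  rw [div_lt_iff₀ hε] at hq
  have hθq : 0 ≤ θ * q := by positivity
  have hp := Nat.floor_le hθq
  have hp' := Nat.lt_floor_add_one (θ * q)
  have hpq : ⌊θ * q⌋₊ ≤ q := by
    have : (⌊θ * q⌋₊ : ℝ) ≤ q := hp.trans (mul_le_of_le_one_left hq₀.le hθ₁)
    exact_mod_cast this
  set p := ⌊θ * q⌋₊
  obtain ⟨B₁, hB₁, hscheme⟩ :=
    exists_mixedScheme (N := N) (K := K) hΛ ht hpq (by exact_mod_cast hq₀)
  refine ⟨B₁, hB₁, fun B hB hdvd => ?_⟩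
  obtain ⟨S, hS, hS', hlen, huser, htx⟩ := hscheme B hB hdvd
  have hB₀ : (0 : ℝ) ≤ B := B.cast_nonneg
  refine ⟨S, hS, hS', ?_, huser, fun U L hL => ?_⟩
  · refine le_of_mul_le_mul_left ?_ hq₀
    rw [hlen, ← mul_assoc]
    refine mul_le_mul_of_nonneg_right ?_ hB₀
    have := mul_le_mul_of_nonneg_right hp hlt.le
    have e : (q : ℝ) * M = q * m t + θ * q * (m (t + 1) - m t) := by
      linear_combination (q : ℝ) * hθ
    rw [e]
    linarith
  · obtain ⟨g, hg, hline⟩ := exists_line_le_secretiveRate hN ht L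
    set R := fun j => secretiveRate Λ j L with hR
    change R (t + 1) - R t = _ at hg
    have henv : R t + g * (M - m t) ≤ lowerConvexEnvelope (cornerPoints N Λ L) M := by
      have hmem : (M, (1 - θ) * R t + θ * R (t + 1)) ∈ convexHull ℝ (cornerPoints N Λ L) := by
        have := convex_convexHull ℝ (cornerPoints N Λ L)
          (subset_convexHull ℝ _ (cornerMemory_mem_cornerPoints hN (by omega : t < Λ) L))
          (subset_convexHull ℝ _ (cornerMemory_mem_cornerPoints hN ht L))
          (sub_nonneg.2 hθ₁) hθ₀ (by ring)
        convert this using 1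
        refine Prod.ext ?_ rfl
        change M = (1 - θ) * m t + θ * m (t + 1)
        linear_combination hθ
      have := line_le_lowerConvexEnvelope (a := R t - g * m t) (g := g) ?_ hmem
      · linarith
      · rintro ⟨x, y⟩ ⟨hx, v, hv, hvx, rfl⟩
        have := hline v hv
        rw [← eq_cornerMemory hN hx hv hvx] at this
        change R t - g * m t + g * x ≤ R v
        change R t + g * (x - m t) ≤ R v at this
        linarith
    have hle : 0 ≤ R t - R (t + 1) := sub_nonneg.2 (secretiveRate_succ_le ht L)
    have hgap : R t - R (t + 1) ≤ q * ε := by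
      have h1 : R t ≤ Λ * K := secretiveRate_le (by omega) (le_card_of_hasProfile hL)
      have h2 : 0 ≤ R (t + 1) := secretiveRate_nonneg _ _ _
      linarith
    refine le_of_mul_le_mul_left ?_ hq₀
    rw [htx U L hL, ← mul_assoc]
    refine mul_le_mul_of_nonneg_right ?_ hB₀
    change (q - p) * R t + p * R (t + 1) ≤ _
    have e : g * (M - m t) = -θ * (R t - R (t + 1)) := by
      rw [hθ]
      linear_combination -θ * hg
    have h1 := mul_le_mul_of_nonneg_left henv hq₀.le
    rw [e] at h1
    have h2 := mul_le_mul_of_nonneg_right hp'.le hle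
    linarith

theorem theorem1 (N K Λ : ℕ) (hΛ : 1 ≤ Λ) (hΛK : Λ ≤ K) (hKN : K ≤ N) :
    -- the points at which `t` is an integer, exactly
    (∀ (M : ℝ) (t : ℕ), 0 ≤ M → t < Λ → (t : ℝ) = (Λ : ℝ) * M / (M + (N : ℝ)) →
      ∃ B₁ : ℕ, 0 < B₁ ∧ ∀ B : ℕ, 0 < B → B₁ ∣ B →
        ∃ S : CachingScheme N K Λ B, S.Correct ∧ S.PerfectlySecret ∧
          (S.helperLen : ℝ) ≤ M * (B : ℝ) ∧ S.userLen ≤ B ∧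
          ∀ (U : Association K Λ) (L : Fin Λ → ℕ), HasProfile U L →
            (S.txLen U : ℝ) = secretiveRate Λ t L * (B : ℝ)) ∧
    -- general `M`: the lower convex envelope, up to an arbitrarily small excess of the rate
    (∀ M : ℝ, 0 ≤ M → M ≤ (N : ℝ) * ((Λ : ℝ) - 1) → ∀ ε : ℝ, 0 < ε →
      ∃ B₁ : ℕ, 0 < B₁ ∧ ∀ B : ℕ, 0 < B → B₁ ∣ B →
        ∃ S : CachingScheme N K Λ B, S.Correct ∧ S.PerfectlySecret ∧
          (S.helperLen : ℝ) ≤ M * (B : ℝ) ∧ S.userLen ≤ B ∧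
          ∀ (U : Association K Λ) (L : Fin Λ → ℕ), HasProfile U L →
            (S.txLen U : ℝ) ≤ (lowerConvexEnvelope (cornerPoints N Λ L) M + ε) * (B : ℝ)) := by
  have hN : 0 < N := by omega
  refine ⟨fun M t hM ht hMt => ?_, fun M hM hM' ε hε => ?_⟩
  · rw [eq_cornerMemory hN hM ht hMt]
    exact exists_cornerScheme hΛ ht
  have h0 : cornerMemory N Λ 0 = 0 := by simp [cornerMemory]
  obtain ⟨n, rfl⟩ | rfl : (∃ n, Λ = n + 2) ∨ Λ = 1 := by
    rcases hΛ.eq_or_lt with h | h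
    · exact .inr h.symm
    · exact .inl ⟨Λ - 2, by omega⟩
  · have hlast : cornerMemory N (n + 2) (n + 1) = N * (((n + 2 : ℕ) : ℝ) - 1) := by
      have : ((n + 2 : ℕ) : ℝ) - ((n + 1 : ℕ) : ℝ) = 1 := by push_cast; ring
      rw [cornerMemory, this]
      push_cast
      ring
    obtain ⟨t, ht, h1, h2⟩ := exists_le_le_succ (f := cornerMemory N (n + 2)) (x := M)
      (by rw [h0]; exact hM) n (by rw [hlast]; exact hM')
    exact exists_envelopeScheme hN hΛ (by omega) h1 h2 hε
  -- With a single helper cache there is a single memory-rate point, at `M = 0`.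
  · obtain rfl : M = 0 := le_antisymm (by simpa using hM') hM
    obtain ⟨B₁, hB₁, hscheme⟩ := exists_cornerScheme (N := N) (K := K) hΛ (t := 0) hΛ
    refine ⟨B₁, hB₁, fun B hB hdvd => ?_⟩
    obtain ⟨S, hS, hS', hlen, huser, htx⟩ := hscheme B hB hdvd
    refine ⟨S, hS, hS', by rwa [h0] at hlen, huser, fun U L hL => ?_⟩
    rw [htx U L hL]
    refine mul_le_mul_of_nonneg_right ?_ B.cast_nonneg
    have hmem := subset_convexHull ℝ _ (cornerMemory_mem_cornerPoints (t := 0) hN hΛ L)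
    rw [h0] at hmem
    have := line_le_lowerConvexEnvelope (a := secretiveRate 1 0 L) (g := 0) ?_ hmem
    · linarith
    · rintro ⟨x, y⟩ ⟨-, v, hv, -, rfl⟩
      obtain rfl : v = 0 := by omega
      simp
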